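/- Formulas are built from a set of propositional variables $p$ by $\varphi ::= p \mid \bot \mid \varphi\land\varphi \mid \varphi\lor\varphi \mid \varphi\to\varphi \mid \Box\varphi \mid \Diamond\varphi$, with $\neg\varphi := \varphi\to\bot$. For a finite multiset $\Gamma$ of formulas, $\Box^{-1}\Gamma$ is the multiset $\{\varphi \mid \Box\varphi\in\Gamma\}$ (with multiplicities), and $\Diamond^{-1}\Gamma$ is defined likewise. **Hilbert calculi.** $\mathsf{CKH}$ derives consecutions $\Gamma\vdash\varphi$, where $\Gamma$ is a set of formulas, by the rules (Ax) $\Gamma\vdash\varphi$ if $\varphi$ is an instance of an axiom; (El) $\Gamma\vdash\varphi$ if $\varphi\in\Gamma$; (MP) from $\Gamma\vdash\varphi$ and $\Gamma\vdash\varphi\to\psi$ infer $\Gamma\vdash\psi$; (Nec) from $\emptyset\vdash\varphi$ infer $\Gamma\vdash\Box\varphi$. The axioms are $\varphi\to(\psi\to\varphi)$; $(\varphi\to(\psi\to\chi))\to((\varphi\to\psi)\to(\varphi\to\chi))$; $\varphi\to(\varphi\lor\psi)$; $\psi\to(\varphi\lor\psi)$; $(\varphi\to\chi)\to((\psi\to\chi)\to((\varphi\lor\psi)\to\chi))$;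 $(\varphi\land\psi)\to\varphi$; $(\varphi\land\psi)\to\psi$; $(\varphi\to\psi)\to((\varphi\to\chi)\to(\varphi\to(\psi\land\chi)))$; $\bot\to\varphi$; $\Box(\varphi\to\psi)\to(\Box\varphi\to\Box\psi)$; $\Box(\varphi\to\psi)\to(\Diamond\varphi\to\Diamond\psi)$. $\mathsf{WKH}$ is $\mathsf{CKH}$ with the additional axiom $\neg\Diamond\bot$. **Sequent calculi.** Sequents are $\Gamma\Rightarrow\Delta$ with $\Gamma,\Delta$ finite multisets of formulas, where $|\Delta|=1$ in $\mathsf{G4CK}$ and $|\Delta|\le 1$ in $\mathsf{G4WK}$. In both calculi the sequents $\Gamma,\bot\Rightarrow\Delta$ and $\Gamma,p\Rightarrow p$ ($p$ a variable) are initial, and the following inferences are rules: - from $\Gamma,\varphi,\psi\Rightarrow\Delta$ infer $\Gamma,\varphi\land\psi\Rightarrow\Delta$; - from $\Gamma\Rightarrow\varphi$ and $\Gamma\Rightarrow\psi$ infer $\Gamma\Rightarrow\varphi\land\psi$; - from $\Gamma,\varphi\Rightarrow\Delta$ and $\Gamma,\psi\Rightarrow\Delta$ infer $\Gamma,\varphi\lor\psi\Rightarrow\Delta$;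 - from $\Gamma\Rightarrow\varphi_i$ infer $\Gamma\Rightarrow\varphi_1\lor\varphi_2$ ($i\in\{1,2\}$); - from $\Gamma,\varphi\Rightarrow\psi$ infer $\Gamma\Rightarrow\varphi\to\psi$; - from $\Gamma,\varphi\to(\psi\to\chi)\Rightarrow\Delta$ infer $\Gamma,(\varphi\land\psi)\to\chi\Rightarrow\Delta$; - from $\Gamma,\varphi\to\chi,\psi\to\chi\Rightarrow\Delta$ infer $\Gamma,(\varphi\lor\psi)\to\chi\Rightarrow\Delta$; - from $\Gamma,p,\varphi\Rightarrow\Delta$ infer $\Gamma,p,p\to\varphi\Rightarrow\Delta$ ($p$ a variable); - from $\Gamma,\psi\to\chi\Rightarrow\varphi\to\psi$ and $\Gamma,\chi\Rightarrow\Delta$ infer $\Gamma,(\varphi\to\psi)\to\chi\Rightarrow\Delta$; - from $\Box^{-1}\Gamma\Rightarrow\varphi$ infer $\Gamma\Rightarrow\Box\varphi$; - from $\Box^{-1}\Gamma\Rightarrow\varphi$ and $\Gamma,\psi\Rightarrow\Delta$ infer $\Gamma,\Box\varphi\to\psi\Rightarrow\Delta$; - from $\Box^{-1}\Gamma,\gamma\Rightarrow\varphi$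 and $\Gamma,\Diamond\gamma,\psi\Rightarrow\Delta$ infer $\Gamma,\Diamond\gamma,\Diamond\varphi\to\psi\Rightarrow\Delta$. $\mathsf{G4CK}$ has in addition the rule: from $\Box^{-1}\Gamma,\varphi\Rightarrow\psi$ infer $\Gamma,\Diamond\varphi\Rightarrow\Diamond\psi$. $\mathsf{G4WK}$ has instead the rule: from $\Box^{-1}\Gamma,\varphi\Rightarrow\Diamond^{-1}\Delta$ infer $\Gamma,\Diamond\varphi\Rightarrow\Delta$. **Theorem.** Let $\Gamma$ be a finite multiset of formulas; on the Hilbert side $\Gamma$ is read as the set of its elements. 1. For every formula $\delta$: $\Gamma\Rightarrow\delta$ is provable in $\mathsf{G4CK}$ if and only if $\Gamma\vdash\delta$ is derivable in $\mathsf{CKH}$. 2. For every multiset $\Delta$ with $|\Delta|\le 1$: $\Gamma\Rightarrow\Delta$ is provable in $\mathsf{G4WK}$ if and only if $\Gamma\vdash\delta$ is derivable in $\mathsf{WKH}$, where $\delta$ is the formula in $\Delta$ if $\Delta$ is a singleton, and $\delta=\bot$ if $\Delta=\emptyset$. -/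

import Mathlib

namespace ConstructiveModal

/-- Formulas of the modal language with independent box and diamond,
over propositional variables from `α`. -/
inductive Formula (α : Type*) where
  | var (p : α) : Formula α
  | bot : Formula α
  | and (φ ψ : Formula α) : Formula α
  | or (φ ψ : Formula α) : Formula α
  | imp (φ ψ : Formula α) : Formula α
  | box (φ : Formula α) : Formula α
  | dia (φ : Formula α) : Formula α

namespace Formula

/-- Negation is an abbreviation. -/
abbrev neg {α : Type*} (φ : Formula α) : Formula α := imp φ bot

/-- `unbox? (□φ) = some φ`, and `none` on all other formulas. -/
def unbox? {α : Type*} : Formula α → Option (Formula α)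
  | box φ => some φ
  | _ => none

/-- `undia? (◇φ) = some φ`, and `none` on all other formulas. -/
def undia? {α : Type*} : Formula α → Option (Formula α)
  | dia φ => some φ
  | _ => none

end Formula

open Formula

/-- The multiset `□⁻¹Γ = {φ | □φ ∈ Γ}`, with multiplicities. -/
def boxInv {α : Type*} (Γ : Multiset (Formula α)) : Multiset (Formula α) :=
  Γ.filterMap unbox?

/-- `◇⁻¹Δ` for a succedent `Δ` with at most one formula:
`◇⁻¹{◇δ} = {δ}`, and it is empty in all other cases. -/
def diaInv {α : Type*} (Δ : Option (Formula α)) : Option (Formula α) :=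
  Δ.bind undia?

/-! ### Generalised Hilbert calculi -/

/-- Instances of the axioms of `CKH`. -/
inductive CKAxiom {α : Type*} : Formula α → Prop
  | a1 (φ ψ : Formula α) : CKAxiom (imp φ (imp ψ φ))
  | a2 (φ ψ χ : Formula α) :
      CKAxiom (imp (imp φ (imp ψ χ)) (imp (imp φ ψ) (imp φ χ)))
  | a3 (φ ψ : Formula α) : CKAxiom (imp φ (or φ ψ))
  | a4 (φ ψ : Formula α) : CKAxiom (imp ψ (or φ ψ))
  | a5 (φ ψ χ : Formula α) :
      CKAxiom (imp (imp φ χ) (imp (imp ψ χ) (imp (or φ ψ) χ)))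
  | a6 (φ ψ : Formula α) : CKAxiom (imp (and φ ψ) φ)
  | a7 (φ ψ : Formula α) : CKAxiom (imp (and φ ψ) ψ)
  | a8 (φ ψ χ : Formula α) :
      CKAxiom (imp (imp φ ψ) (imp (imp φ χ) (imp φ (and ψ χ))))
  | a9 (φ : Formula α) : CKAxiom (imp bot φ)
  | kBox (φ ψ : Formula α) :
      CKAxiom (imp (box (imp φ ψ)) (imp (box φ) (box ψ)))
  | kDia (φ ψ : Formula α) :
      CKAxiom (imp (box (imp φ ψ)) (imp (dia φ) (dia ψ)))

/-- Instances of the axioms of `WKH`: those of `CKH` and the axiom `N`, that is `¬◇⊥`. -/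
inductive WKAxiom {α : Type*} : Formula α → Prop
  | ofCK {φ : Formula α} (h : CKAxiom φ) : WKAxiom φ
  | n : WKAxiom (neg (dia bot))

/-- Provability of consecutions `Γ ⊢ φ`, with `Γ` an arbitrary set of formulas, in the
generalised Hilbert calculus with the axioms `Ax`. -/
inductive Hilbert {α : Type*} (Ax : Formula α → Prop) : Set (Formula α) → Formula α → Prop
  | ax {Γ : Set (Formula α)} {φ : Formula α} (h : Ax φ) : Hilbert Ax Γ φ
  | el {Γ : Set (Formula α)} {φ : Formula α} (h : φ ∈ Γ) : Hilbert Ax Γ φ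
  | nec {Γ : Set (Formula α)} {φ : Formula α} (h : Hilbert Ax ∅ φ) : Hilbert Ax Γ (box φ)
  | mp {Γ : Set (Formula α)} {φ ψ : Formula α} (h₁ : Hilbert Ax Γ φ)
      (h₂ : Hilbert Ax Γ (imp φ ψ)) : Hilbert Ax Γ ψ

/-- `Γ ⊢ φ` in `CKH`. -/
def CKH {α : Type*} (Γ : Set (Formula α)) (φ : Formula α) : Prop := Hilbert CKAxiom Γ φ

/-- `Γ ⊢ φ` in `WKH`. -/
def WKH {α : Type*} (Γ : Set (Formula α)) (φ : Formula α) : Prop := Hilbert WKAxiom Γ φ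

/-! ### Sequent calculi

Antecedents are finite multisets; `φ ::ₘ Γ` is the multiset written `Γ, φ`. -/

/-- Provability in `G4CK` of `Γ ⇒ δ`; succedents have exactly one formula. -/
inductive G4CK {α : Type*} : Multiset (Formula α) → Formula α → Prop
  | botL (Γ : Multiset (Formula α)) (δ : Formula α) : G4CK (bot ::ₘ Γ) δ
  | idP (Γ : Multiset (Formula α)) (p : α) : G4CK (var p ::ₘ Γ) (var p)
  | andL {Γ : Multiset (Formula α)} {φ ψ δ : Formula α}
      (h : G4CK (φ ::ₘ ψ ::ₘ Γ) δ) : G4CK (and φ ψ ::ₘ Γ) δ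
  | andR {Γ : Multiset (Formula α)} {φ ψ : Formula α}
      (h₁ : G4CK Γ φ) (h₂ : G4CK Γ ψ) : G4CK Γ (and φ ψ)
  | orL {Γ : Multiset (Formula α)} {φ ψ δ : Formula α}
      (h₁ : G4CK (φ ::ₘ Γ) δ) (h₂ : G4CK (ψ ::ₘ Γ) δ) : G4CK (or φ ψ ::ₘ Γ) δ
  | orR₁ {Γ : Multiset (Formula α)} {φ ψ : Formula α}
      (h : G4CK Γ φ) : G4CK Γ (or φ ψ)
  | orR₂ {Γ : Multiset (Formula α)} {φ ψ : Formula α}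
      (h : G4CK Γ ψ) : G4CK Γ (or φ ψ)
  | impR {Γ : Multiset (Formula α)} {φ ψ : Formula α}
      (h : G4CK (φ ::ₘ Γ) ψ) : G4CK Γ (imp φ ψ)
  | andImpL {Γ : Multiset (Formula α)} {φ ψ χ δ : Formula α}
      (h : G4CK (imp φ (imp ψ χ) ::ₘ Γ) δ) : G4CK (imp (and φ ψ) χ ::ₘ Γ) δ
  | orImpL {Γ : Multiset (Formula α)} {φ ψ χ δ : Formula α}
      (h : G4CK (imp φ χ ::ₘ imp ψ χ ::ₘ Γ) δ) : G4CK (imp (or φ ψ) χ ::ₘ Γ) δ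
  | varImpL {Γ : Multiset (Formula α)} {p : α} {φ δ : Formula α}
      (h : G4CK (var p ::ₘ φ ::ₘ Γ) δ) : G4CK (var p ::ₘ imp (var p) φ ::ₘ Γ) δ
  | impImpL {Γ : Multiset (Formula α)} {φ ψ χ δ : Formula α}
      (h₁ : G4CK (imp ψ χ ::ₘ Γ) (imp φ ψ)) (h₂ : G4CK (χ ::ₘ Γ) δ) :
      G4CK (imp (imp φ ψ) χ ::ₘ Γ) δ
  | boxR {Γ : Multiset (Formula α)} {φ : Formula α}
      (h : G4CK (boxInv Γ) φ) : G4CK Γ (box φ)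
  | boxImpL {Γ : Multiset (Formula α)} {φ ψ δ : Formula α}
      (h₁ : G4CK (boxInv Γ) φ) (h₂ : G4CK (ψ ::ₘ Γ) δ) : G4CK (imp (box φ) ψ ::ₘ Γ) δ
  | diaImpL {Γ : Multiset (Formula α)} {γ φ ψ δ : Formula α}
      (h₁ : G4CK (γ ::ₘ boxInv Γ) φ) (h₂ : G4CK (dia γ ::ₘ ψ ::ₘ Γ) δ) :
      G4CK (dia γ ::ₘ imp (dia φ) ψ ::ₘ Γ) δ
  | diaL {Γ : Multiset (Formula α)} {φ ψ : Formula α}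
      (h : G4CK (φ ::ₘ boxInv Γ) ψ) : G4CK (dia φ ::ₘ Γ) (dia ψ)

/-- Provability in `G4WK` of `Γ ⇒ Δ`; succedents have at most one formula, `none` standing
for the empty succedent and `some δ` for the singleton `{δ}`. -/
inductive G4WK {α : Type*} : Multiset (Formula α) → Option (Formula α) → Prop
  | botL (Γ : Multiset (Formula α)) (Δ : Option (Formula α)) : G4WK (bot ::ₘ Γ) Δ
  | idP (Γ : Multiset (Formula α)) (p : α) : G4WK (var p ::ₘ Γ) (some (var p))
  | andL {Γ : Multiset (Formula α)} {φ ψ : Formula α} {Δ : Option (Formula α)}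
      (h : G4WK (φ ::ₘ ψ ::ₘ Γ) Δ) : G4WK (and φ ψ ::ₘ Γ) Δ
  | andR {Γ : Multiset (Formula α)} {φ ψ : Formula α}
      (h₁ : G4WK Γ (some φ)) (h₂ : G4WK Γ (some ψ)) : G4WK Γ (some (and φ ψ))
  | orL {Γ : Multiset (Formula α)} {φ ψ : Formula α} {Δ : Option (Formula α)}
      (h₁ : G4WK (φ ::ₘ Γ) Δ) (h₂ : G4WK (ψ ::ₘ Γ) Δ) : G4WK (or φ ψ ::ₘ Γ) Δ
  | orR₁ {Γ : Multiset (Formula α)} {φ ψ : Formula α}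
      (h : G4WK Γ (some φ)) : G4WK Γ (some (or φ ψ))
  | orR₂ {Γ : Multiset (Formula α)} {φ ψ : Formula α}
      (h : G4WK Γ (some ψ)) : G4WK Γ (some (or φ ψ))
  | impR {Γ : Multiset (Formula α)} {φ ψ : Formula α}
      (h : G4WK (φ ::ₘ Γ) (some ψ)) : G4WK Γ (some (imp φ ψ))
  | andImpL {Γ : Multiset (Formula α)} {φ ψ χ : Formula α} {Δ : Option (Formula α)}
      (h : G4WK (imp φ (imp ψ χ) ::ₘ Γ) Δ) : G4WK (imp (and φ ψ) χ ::ₘ Γ) Δ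
  | orImpL {Γ : Multiset (Formula α)} {φ ψ χ : Formula α} {Δ : Option (Formula α)}
      (h : G4WK (imp φ χ ::ₘ imp ψ χ ::ₘ Γ) Δ) : G4WK (imp (or φ ψ) χ ::ₘ Γ) Δ
  | varImpL {Γ : Multiset (Formula α)} {p : α} {φ : Formula α} {Δ : Option (Formula α)}
      (h : G4WK (var p ::ₘ φ ::ₘ Γ) Δ) : G4WK (var p ::ₘ imp (var p) φ ::ₘ Γ) Δ
  | impImpL {Γ : Multiset (Formula α)} {φ ψ χ : Formula α} {Δ : Option (Formula α)}
      (h₁ : G4WK (imp ψ χ ::ₘ Γ) (some (imp φ ψ))) (h₂ : G4WK (χ ::ₘ Γ) Δ) :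
      G4WK (imp (imp φ ψ) χ ::ₘ Γ) Δ
  | boxR {Γ : Multiset (Formula α)} {φ : Formula α}
      (h : G4WK (boxInv Γ) (some φ)) : G4WK Γ (some (box φ))
  | boxImpL {Γ : Multiset (Formula α)} {φ ψ : Formula α} {Δ : Option (Formula α)}
      (h₁ : G4WK (boxInv Γ) (some φ)) (h₂ : G4WK (ψ ::ₘ Γ) Δ) :
      G4WK (imp (box φ) ψ ::ₘ Γ) Δ
  | diaImpL {Γ : Multiset (Formula α)} {γ φ ψ : Formula α} {Δ : Option (Formula α)}
      (h₁ : G4WK (γ ::ₘ boxInv Γ) (some φ)) (h₂ : G4WK (dia γ ::ₘ ψ ::ₘ Γ) Δ) :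
      G4WK (dia γ ::ₘ imp (dia φ) ψ ::ₘ Γ) Δ
  | diaL' {Γ : Multiset (Formula α)} {φ : Formula α} {Δ : Option (Formula α)}
      (h : G4WK (φ ::ₘ boxInv Γ) (diaInv Δ)) : G4WK (dia φ ::ₘ Γ) Δ

/-- The formula denoted by a succedent: `δ` for `{δ}`, and `⊥` for the empty succedent. -/
def succedentFormula {α : Type*} : Option (Formula α) → Formula α
  | some δ => δ
  | none => bot

end ConstructiveModal

namespace ConstructiveModal

open Formula

variable {α : Type*}

/-! Soundness: Hilbert derivability is closed under every sequent rule. The notion `G4Closed`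
isolates the rules shared by both calculi, so each direction is proved once for an arbitrary axiom
set.

Completeness needs no cut elimination. Let `Γ ⊢ δ` be Hilbert derivable and induct on the total size
of the sequent, using the Aczel slash relative to `Γ`. If some member of `Γ` is not slashed, a left
rule with that principal formula has smaller, still derivable premises (`G4Closed.of_not_slash`). If
all members are slashed and so are the axioms, then every consequence of `Γ` is slashed
(`Hilbert.slash`), in particular `δ`. A slashed `δ` is obtained by an initial sequent or a right or
modal rule: the slash picks the disjunct or the diamond to use, and the premises are again smaller
and derivable.

All axioms of `CKH` are slashed (`CKAxiom.slash`). The axiom `¬◇⊥` can fail to be slashed only if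
some `◇γ` in `Γ` has `□⁻¹Γ, γ ⊢ ⊥`, which is the premise of the extra diamond rule of `G4WK`. -/

/-- The axiom set `Ax` contains all axioms of `CKH`. -/
class ContainsCK (Ax : Formula α → Prop) : Prop where
  ofCK : ∀ {φ : Formula α}, CKAxiom φ → Ax φ

instance : ContainsCK (CKAxiom (α := α)) := ⟨id⟩

instance : ContainsCK (WKAxiom (α := α)) := ⟨WKAxiom.ofCK⟩

/-! ### Derived rules of the Hilbert calculi -/

namespace Hilbert

variable {Ax : Formula α → Prop} {S T : Set (Formula α)} {φ ψ χ δ : Formula α}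

theorem trans (h : Hilbert Ax T ψ) : ∀ {S : Set (Formula α)},
    (∀ τ ∈ T, Hilbert Ax S τ) → Hilbert Ax S ψ := by
  induction h with
  | ax h => exact fun _ => .ax h
  | el h => exact fun hS => hS _ h
  | nec h _ => exact fun _ => .nec h
  | mp _ _ ih₁ ih₂ => exact fun hS => .mp (ih₁ hS) (ih₂ hS)

theorem mono (h : Hilbert Ax T ψ) (hTS : T ⊆ S) : Hilbert Ax S ψ :=
  h.trans fun _ hτ => .el (hTS hτ)

theorem self_insert : Hilbert Ax (insert φ S) φ := .el (Set.mem_insert _ _)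

theorem weaken (h : Hilbert Ax S ψ) : Hilbert Ax (insert φ S) ψ :=
  h.mono (Set.subset_insert _ _)

theorem replace (h : Hilbert Ax (insert φ T) ψ) (hφ : Hilbert Ax S φ) (hT : T ⊆ S) :
    Hilbert Ax S ψ :=
  h.trans fun _ hτ => hτ.elim (fun e => e ▸ hφ) fun hτ => .el (hT hτ)

theorem replace₂ (h : Hilbert Ax (insert φ (insert χ T)) ψ) (hφ : Hilbert Ax S φ)
    (hχ : Hilbert Ax S χ) (hT : T ⊆ S) : Hilbert Ax S ψ :=
  h.trans fun _ hτ => hτ.elim (fun e => e ▸ hφ) fun hτ =>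
    hτ.elim (fun e => e ▸ hχ) fun hτ => .el (hT hτ)

theorem undeduct (h : Hilbert Ax S (imp φ ψ)) : Hilbert Ax (insert φ S) ψ :=
  .mp self_insert h.weaken

variable [ContainsCK Ax]

theorem ck (h : CKAxiom φ) : Hilbert Ax S φ := .ax (ContainsCK.ofCK h)

theorem ck_mp (h : CKAxiom (imp φ ψ)) (hφ : Hilbert Ax S φ) : Hilbert Ax S ψ := .mp hφ (ck h)

theorem const (h : Hilbert Ax S ψ) : Hilbert Ax S (imp φ ψ) := ck_mp (.a1 ψ φ) h

theorem deduct (h : Hilbert Ax (insert φ S) ψ) : Hilbert Ax S (imp φ ψ) := by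
  generalize hT : insert φ S = T at h
  induction h with
  | ax h => exact const (.ax h)
  | el h =>
    subst hT
    rcases h with rfl | h
    -- The identity as SKK; `bot` is an arbitrary filler.
    · exact .mp (ck (.a1 _ bot)) (ck_mp (.a2 _ (imp bot _) _) (ck (.a1 _ _)))
    · exact const (.el h)
  -- Necessitation starts from the empty context, so the discharged formula plays no role above it.
  | nec h _ => exact const (.nec h)
  | mp _ _ ih₁ ih₂ => exact .mp (ih₁ hT) (ck_mp (.a2 _ _ _) (ih₂ hT))

theorem and_intro (h₁ : Hilbert Ax S φ) (h₂ : Hilbert Ax S ψ) : Hilbert Ax S (and φ ψ) :=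
  .mp (ck (.a1 φ φ)) <| .mp (const h₂) <| ck_mp (.a8 _ _ _) (const h₁)

theorem and_left (h : Hilbert Ax S (and φ ψ)) : Hilbert Ax S φ := ck_mp (.a6 _ _) h

theorem and_right (h : Hilbert Ax S (and φ ψ)) : Hilbert Ax S ψ := ck_mp (.a7 _ _) h

theorem or_inl (h : Hilbert Ax S φ) : Hilbert Ax S (or φ ψ) := ck_mp (.a3 _ _) h

theorem or_inr (h : Hilbert Ax S ψ) : Hilbert Ax S (or φ ψ) := ck_mp (.a4 _ _) h

theorem or_elim (h : Hilbert Ax S (or φ ψ)) (h₁ : Hilbert Ax (insert φ S) χ)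
    (h₂ : Hilbert Ax (insert ψ S) χ) : Hilbert Ax S χ :=
  .mp h <| .mp h₂.deduct <| ck_mp (.a5 _ _ _) h₁.deduct

theorem exfalso (h : Hilbert Ax S bot) : Hilbert Ax S φ := ck_mp (.a9 _) h

theorem box_intro (h : Hilbert Ax T φ) (hT : ∀ τ ∈ T, box τ ∈ S) : Hilbert Ax S (box φ) := by
  induction h with
  | ax h => exact .nec (.ax h)
  | el h => exact .el (hT _ h)
  | nec h _ => exact .nec (.nec h)
  | mp _ _ ih₁ ih₂ => exact .mp (ih₁ hT) (ck_mp (.kBox _ _) (ih₂ hT))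

theorem dia_mono (h : Hilbert Ax (insert φ T) ψ) (hT : ∀ τ ∈ T, box τ ∈ S)
    (hφ : Hilbert Ax S (dia φ)) : Hilbert Ax S (dia ψ) :=
  .mp hφ (ck_mp (.kDia _ _) (h.deduct.box_intro hT))

/-- Under `φ`, the formulas `(φ → ψ) → χ` and `ψ → χ` are equivalent. -/
theorem imp_imp_iff : Hilbert Ax (insert (imp (imp φ ψ) χ) S) (imp φ ψ) ↔
    Hilbert Ax (insert (imp ψ χ) S) (imp φ ψ) := by
  constructor <;> intro h <;> apply deduct
  · have hχ : Hilbert Ax (insert φ (insert (imp ψ χ) S)) (imp (imp φ ψ) χ) :=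
      deduct <| .mp (.mp self_insert.weaken self_insert) self_insert.weaken.weaken
    exact .mp self_insert <| h.replace hχ <|
      (Set.subset_insert _ _).trans (Set.subset_insert _ _)
  · have hχ : Hilbert Ax (insert φ (insert (imp (imp φ ψ) χ) S)) (imp ψ χ) :=
      deduct <| .mp self_insert.const self_insert.weaken.weaken
    exact .mp self_insert <| h.replace hχ <|
      (Set.subset_insert _ _).trans (Set.subset_insert _ _)

end Hilbert

/-! ### Multisets of formulas -/

@[simp]
theorem setOf_mem_cons (φ : Formula α) (Γ : Multiset (Formula α)) :
    {x | x ∈ φ ::ₘ Γ} = insert φ {x | x ∈ Γ} := by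
  ext; simp

theorem mem_boxInv {φ : Formula α} {Γ : Multiset (Formula α)} :
    φ ∈ boxInv Γ ↔ box φ ∈ Γ := by
  simp only [boxInv, Multiset.mem_filterMap]
  constructor
  · rintro ⟨a, ha, h⟩
    cases a <;> simp_all [unbox?]
  · exact fun h => ⟨_, h, rfl⟩

/-! ### The common rules of the sequent calculi -/

/-- Closure of a relation between antecedents and succedent formulas under the rules
of `G4CK`. -/
structure G4Closed (P : Multiset (Formula α) → Formula α → Prop) : Prop where
  botL : ∀ (Γ : Multiset (Formula α)) (δ : Formula α), P (bot ::ₘ Γ) δ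
  idP : ∀ (Γ : Multiset (Formula α)) (p : α), P (var p ::ₘ Γ) (var p)
  andL : ∀ {Γ : Multiset (Formula α)} {φ ψ δ : Formula α},
    P (φ ::ₘ ψ ::ₘ Γ) δ → P (and φ ψ ::ₘ Γ) δ
  andR : ∀ {Γ : Multiset (Formula α)} {φ ψ : Formula α}, P Γ φ → P Γ ψ → P Γ (and φ ψ)
  orL : ∀ {Γ : Multiset (Formula α)} {φ ψ δ : Formula α},
    P (φ ::ₘ Γ) δ → P (ψ ::ₘ Γ) δ → P (or φ ψ ::ₘ Γ) δ
  orR₁ : ∀ {Γ : Multiset (Formula α)} {φ ψ : Formula α}, P Γ φ → P Γ (or φ ψ)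
  orR₂ : ∀ {Γ : Multiset (Formula α)} {φ ψ : Formula α}, P Γ ψ → P Γ (or φ ψ)
  impR : ∀ {Γ : Multiset (Formula α)} {φ ψ : Formula α}, P (φ ::ₘ Γ) ψ → P Γ (imp φ ψ)
  andImpL : ∀ {Γ : Multiset (Formula α)} {φ ψ χ δ : Formula α},
    P (imp φ (imp ψ χ) ::ₘ Γ) δ → P (imp (and φ ψ) χ ::ₘ Γ) δ
  orImpL : ∀ {Γ : Multiset (Formula α)} {φ ψ χ δ : Formula α},
    P (imp φ χ ::ₘ imp ψ χ ::ₘ Γ) δ → P (imp (or φ ψ) χ ::ₘ Γ) δ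
  varImpL : ∀ {Γ : Multiset (Formula α)} {p : α} {φ δ : Formula α},
    P (var p ::ₘ φ ::ₘ Γ) δ → P (var p ::ₘ imp (var p) φ ::ₘ Γ) δ
  impImpL : ∀ {Γ : Multiset (Formula α)} {φ ψ χ δ : Formula α},
    P (imp ψ χ ::ₘ Γ) (imp φ ψ) → P (χ ::ₘ Γ) δ → P (imp (imp φ ψ) χ ::ₘ Γ) δ
  boxR : ∀ {Γ : Multiset (Formula α)} {φ : Formula α}, P (boxInv Γ) φ → P Γ (box φ)
  boxImpL : ∀ {Γ : Multiset (Formula α)} {φ ψ δ : Formula α},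
    P (boxInv Γ) φ → P (ψ ::ₘ Γ) δ → P (imp (box φ) ψ ::ₘ Γ) δ
  diaImpL : ∀ {Γ : Multiset (Formula α)} {γ φ ψ δ : Formula α},
    P (γ ::ₘ boxInv Γ) φ → P (dia γ ::ₘ ψ ::ₘ Γ) δ → P (dia γ ::ₘ imp (dia φ) ψ ::ₘ Γ) δ
  diaL : ∀ {Γ : Multiset (Formula α)} {φ ψ : Formula α},
    P (φ ::ₘ boxInv Γ) ψ → P (dia φ ::ₘ Γ) (dia ψ)

theorem g4Closed_G4CK : G4Closed (G4CK (α := α)) :=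
  ⟨.botL, .idP, .andL, .andR, .orL, .orR₁, .orR₂, .impR, .andImpL, .orImpL, .varImpL, .impImpL,
    .boxR, .boxImpL, .diaImpL, .diaL⟩

/-- The diamond rule of `G4CK` is the case of `diaL'` where `diaInv (some (dia ψ))` computes to
`some ψ`. -/
theorem g4Closed_G4WK : G4Closed fun (Γ : Multiset (Formula α)) δ => G4WK Γ (some δ) :=
  ⟨fun Γ δ => .botL Γ (some δ), .idP, .andL, .andR, .orL, .orR₁, .orR₂, .impR, .andImpL, .orImpL,
    .varImpL, .impImpL, .boxR, .boxImpL, .diaImpL, fun h => .diaL' h⟩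

/-! ### Hilbert derivability is closed under the sequent rules -/

section Soundness

open Hilbert

variable {Ax : Formula α → Prop} [ContainsCK Ax]

theorem g4Closed_hilbert :
    G4Closed fun (Γ : Multiset (Formula α)) δ => Hilbert Ax {x | x ∈ Γ} δ where
  botL Γ δ := by
    rw [setOf_mem_cons]
    exact self_insert.exfalso
  idP Γ p := by
    rw [setOf_mem_cons]
    exact self_insert
  andL h := by
    simp only [setOf_mem_cons] at h ⊢
    exact h.replace₂ self_insert.and_left self_insert.and_right (Set.subset_insert _ _)
  andR := and_intro
  orL h₁ h₂ := by
    simp only [setOf_mem_cons] at h₁ h₂ ⊢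
    exact self_insert.or_elim (h₁.mono (Set.insert_subset_insert (Set.subset_insert _ _)))
      (h₂.mono (Set.insert_subset_insert (Set.subset_insert _ _)))
  orR₁ := or_inl
  orR₂ := or_inr
  impR h := by
    simp only [setOf_mem_cons] at h
    exact h.deduct
  andImpL h := by
    simp only [setOf_mem_cons] at h ⊢
    exact h.replace (deduct <| deduct <|
      .mp (and_intro self_insert.weaken self_insert) self_insert.weaken.weaken)
      (Set.subset_insert _ _)
  orImpL h := by
    simp only [setOf_mem_cons] at h ⊢
    exact h.replace₂ (deduct <| .mp self_insert.or_inl self_insert.weaken)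
      (deduct <| .mp self_insert.or_inr self_insert.weaken) (Set.subset_insert _ _)
  varImpL h := by
    simp only [setOf_mem_cons] at h ⊢
    exact h.replace₂ self_insert (.mp self_insert self_insert.weaken)
      ((Set.subset_insert _ _).trans (Set.subset_insert _ _))
  impImpL h₁ h₂ := by
    simp only [setOf_mem_cons] at h₁ h₂ ⊢
    exact h₂.replace (.mp (imp_imp_iff.2 h₁) self_insert) (Set.subset_insert _ _)
  boxR h := h.box_intro fun _ => mem_boxInv.1
  boxImpL h₁ h₂ := by
    simp only [setOf_mem_cons] at h₂ ⊢
    exact h₂.replace (.mp (h₁.box_intro fun _ hτ => .inr (mem_boxInv.1 hτ)) self_insert)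
      (Set.subset_insert _ _)
  diaImpL h₁ h₂ := by
    simp only [setOf_mem_cons] at h₁ h₂ ⊢
    exact h₂.replace₂ self_insert
      (.mp (h₁.dia_mono (fun _ hτ => .inr (.inr (mem_boxInv.1 hτ))) self_insert)
        self_insert.weaken) ((Set.subset_insert _ _).trans (Set.subset_insert _ _))
  diaL h := by
    simp only [setOf_mem_cons] at h ⊢
    exact h.dia_mono (fun _ hτ => .inr (mem_boxInv.1 hτ)) self_insert

end Soundness

/-- Minimality of `G4CK` among closed relations; soundness is the instance where `P` is Hilbert
derivability. -/
theorem G4CK.sound {P : Multiset (Formula α) → Formula α → Prop} (hP : G4Closed P)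
    {Γ : Multiset (Formula α)} {δ : Formula α} (h : G4CK Γ δ) : P Γ δ := by
  induction h with
  | botL Γ δ => exact hP.botL Γ δ
  | idP Γ p => exact hP.idP Γ p
  | andL _ ih => exact hP.andL ih
  | andR _ _ ih₁ ih₂ => exact hP.andR ih₁ ih₂
  | orL _ _ ih₁ ih₂ => exact hP.orL ih₁ ih₂
  | orR₁ _ ih => exact hP.orR₁ ih
  | orR₂ _ ih => exact hP.orR₂ ih
  | impR _ ih => exact hP.impR ih
  | andImpL _ ih => exact hP.andImpL ih
  | orImpL _ ih => exact hP.orImpL ih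
  | varImpL _ ih => exact hP.varImpL ih
  | impImpL _ _ ih₁ ih₂ => exact hP.impImpL ih₁ ih₂
  | boxR _ ih => exact hP.boxR ih
  | boxImpL _ _ ih₁ ih₂ => exact hP.boxImpL ih₁ ih₂
  | diaImpL _ _ ih₁ ih₂ => exact hP.diaImpL ih₁ ih₂
  | diaL _ ih => exact hP.diaL ih

theorem diaInv_eq_none_or (Δ : Option (Formula α)) :
    diaInv Δ = none ∨ ∃ ψ, Δ = some (dia ψ) := by
  rcases Δ with _ | δ
  · exact .inl rfl
  · cases δ <;> simp [diaInv, undia?]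

theorem G4WK.sound {P : Multiset (Formula α) → Formula α → Prop} (hP : G4Closed P)
    (hN : ∀ {Γ : Multiset (Formula α)} {φ δ : Formula α},
      P (φ ::ₘ boxInv Γ) bot → P (dia φ ::ₘ Γ) δ)
    {Γ : Multiset (Formula α)} {Δ : Option (Formula α)} (h : G4WK Γ Δ) :
    P Γ (succedentFormula Δ) := by
  induction h with
  | botL Γ Δ => exact hP.botL Γ _
  | idP Γ p => exact hP.idP Γ p
  | andL _ ih => exact hP.andL ih
  | andR _ _ ih₁ ih₂ => exact hP.andR ih₁ ih₂
  | orL _ _ ih₁ ih₂ => exact hP.orL ih₁ ih₂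
  | orR₁ _ ih => exact hP.orR₁ ih
  | orR₂ _ ih => exact hP.orR₂ ih
  | impR _ ih => exact hP.impR ih
  | andImpL _ ih => exact hP.andImpL ih
  | orImpL _ ih => exact hP.orImpL ih
  | varImpL _ ih => exact hP.varImpL ih
  | impImpL _ _ ih₁ ih₂ => exact hP.impImpL ih₁ ih₂
  | boxR _ ih => exact hP.boxR ih
  | boxImpL _ _ ih₁ ih₂ => exact hP.boxImpL ih₁ ih₂
  | diaImpL _ _ ih₁ ih₂ => exact hP.diaImpL ih₁ ih₂
  | @diaL' _ _ Δ _ ih =>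
    rcases diaInv_eq_none_or Δ with e | ⟨ψ, rfl⟩
    · rw [e] at ih
      exact hN ih
    · exact hP.diaL ih

/-- No right rule ends in an empty succedent or in `⊥`, so the succedent is only carried along and
can be exchanged throughout. In `diaL'` both possibilities become empty in the premise, where
`diaInv Δ'` is put instead. -/
theorem G4WK.exfalso {Γ : Multiset (Formula α)} {Δ : Option (Formula α)} (h : G4WK Γ Δ)
    (hΔ : Δ = none ∨ Δ = some bot) (Δ' : Option (Formula α)) : G4WK Γ Δ' := by
  induction h generalizing Δ' with
  | botL Γ _ => exact .botL Γ Δ'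
  | idP | andR | orR₁ | orR₂ | impR | boxR => simp at hΔ
  | andL _ ih => exact .andL (ih hΔ _)
  | orL _ _ ih₁ ih₂ => exact .orL (ih₁ hΔ _) (ih₂ hΔ _)
  | andImpL _ ih => exact .andImpL (ih hΔ _)
  | orImpL _ ih => exact .orImpL (ih hΔ _)
  | varImpL _ ih => exact .varImpL (ih hΔ _)
  | impImpL h₁ _ _ ih₂ => exact .impImpL h₁ (ih₂ hΔ _)
  | boxImpL h₁ _ _ ih₂ => exact .boxImpL h₁ (ih₂ hΔ _)
  | diaImpL h₁ _ _ ih₂ => exact .diaImpL h₁ (ih₂ hΔ _)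
  | diaL' _ ih => exact .diaL' (ih (by rcases hΔ with rfl | rfl <;> exact .inl rfl) _)

/-! ### Termination measure -/

/-- The weight of a formula. -/
def Formula.weight : Formula α → ℕ
  | var _ => 1
  | bot => 1
  -- The 2 makes `φ → (ψ → χ)` lighter than `(φ ∧ ψ) → χ`; with 1 they would weigh the same.
  | and φ ψ => φ.weight + ψ.weight + 2
  | or φ ψ => φ.weight + ψ.weight + 1
  | imp φ ψ => φ.weight + ψ.weight + 1
  | box φ => φ.weight + 1
  | dia φ => φ.weight + 1

/-- An exponential size, chosen so that replacing a formula by two formulas of smaller weight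
decreases the total. -/
def Formula.size (φ : Formula α) : ℕ := 3 ^ φ.weight

/-- The total size of the formulas of a multiset. -/
def totalSize (Γ : Multiset (Formula α)) : ℕ := (Γ.map Formula.size).sum

@[simp]
theorem totalSize_cons (φ : Formula α) (Γ : Multiset (Formula α)) :
    totalSize (φ ::ₘ Γ) = φ.size + totalSize Γ := by
  simp [totalSize]

theorem Formula.size_pos (φ : Formula α) : 0 < φ.size := by
  simp [Formula.size]

/-- This is `2 * 3 ^ n < 3 ^ (n + 1)`; base 2 would only give `≤`. -/
theorem Formula.size_add_lt {φ ψ χ : Formula α} (h₁ : φ.weight < χ.weight)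
    (h₂ : ψ.weight < χ.weight) : φ.size + ψ.size < χ.size := by
  obtain ⟨n, hn⟩ : ∃ n, χ.weight = n + 1 := ⟨χ.weight - 1, by omega⟩
  have h₁' : φ.size ≤ 3 ^ n := Nat.pow_le_pow_right (by norm_num) (by omega)
  have h₂' : ψ.size ≤ 3 ^ n := Nat.pow_le_pow_right (by norm_num) (by omega)
  have hχ : χ.size = 3 ^ n * 3 := by rw [Formula.size, hn, pow_succ]
  have : 0 < 3 ^ n := by positivity
  omega

theorem Formula.size_lt {φ χ : Formula α} (h : φ.weight < χ.weight) : φ.size < χ.size :=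
  Nat.pow_lt_pow_right (by norm_num) h

theorem totalSize_boxInv_le (Γ : Multiset (Formula α)) : totalSize (boxInv Γ) ≤ totalSize Γ := by
  induction Γ using Multiset.induction with
  | empty => simp [boxInv]
  | cons φ Γ ih =>
    cases φ with
    | box φ =>
      have e : boxInv (box φ ::ₘ Γ) = φ ::ₘ boxInv Γ :=
        Multiset.filterMap_cons_some _ _ _ rfl
      have : φ.size < (box φ).size := Formula.size_lt (by simp [Formula.weight])
      simp only [e, totalSize_cons]
      omega
    | _ =>
      rw [boxInv, Multiset.filterMap_cons_none _ _ rfl, totalSize_cons]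
      exact ih.trans (Nat.le_add_left _ _)

theorem boxInv_cons {φ : Formula α} (hφ : φ.unbox? = none) (Γ : Multiset (Formula α)) :
    boxInv (φ ::ₘ Γ) = boxInv Γ :=
  Multiset.filterMap_cons_none _ _ hφ

/-! ### The slash relation -/

/-- The Aczel slash `Γ ∣ φ`, with modal clauses. -/
def Slash (Ax : Formula α → Prop) (Γ : Multiset (Formula α)) : Formula α → Prop
  | .var p => var p ∈ Γ
  | .bot => False
  | .and φ ψ => Slash Ax Γ φ ∧ Slash Ax Γ ψ
  | .or φ ψ => Slash Ax Γ φ ∨ Slash Ax Γ ψ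
  | .imp φ ψ => Hilbert Ax {x | x ∈ Γ} (imp φ ψ) ∧ (Slash Ax Γ φ → Slash Ax Γ ψ)
  -- The modal clauses ask for derivability rather than the slash of `φ`: they are the Hilbert
  -- readings of the premises of `boxR` and `diaL`.
  | .box φ => Hilbert Ax {x | x ∈ boxInv Γ} φ
  | .dia φ => ∃ γ, dia γ ∈ Γ ∧ Hilbert Ax (insert γ {x | x ∈ boxInv Γ}) φ

section Slash

open Hilbert

variable {Ax : Formula α → Prop} {Γ : Multiset (Formula α)}

theorem Hilbert.slash (hAx : ∀ φ, Ax φ → Slash Ax Γ φ) (hΓ : ∀ γ ∈ Γ, Slash Ax Γ γ)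
    {φ : Formula α} (h : Hilbert Ax {x | x ∈ Γ} φ) : Slash Ax Γ φ := by
  generalize hT : {x | x ∈ Γ} = T at h
  induction h with
  | ax h => exact hAx _ h
  | el h => subst hT; exact hΓ _ h
  | nec h _ => exact h.mono (Set.empty_subset _)
  | mp _ _ ih₁ ih₂ => exact (ih₂ hT).2 (ih₁ hT)

variable [ContainsCK Ax]

theorem Slash.hilbert : ∀ {φ : Formula α}, Slash Ax Γ φ → Hilbert Ax {x | x ∈ Γ} φ
  | .var _, h => .el h
  | .bot, h => h.elim
  | .and _ _, h => and_intro (Slash.hilbert h.1) (Slash.hilbert h.2)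
  | .or _ _, h => h.elim (fun h => or_inl (Slash.hilbert h)) fun h => or_inr (Slash.hilbert h)
  | .imp _ _, h => h.1
  | .box _, h => box_intro h fun _ => mem_boxInv.1
  | .dia _, ⟨_, hγ, h⟩ => h.dia_mono (fun _ => mem_boxInv.1) (.el hγ)

theorem CKAxiom.slash {φ : Formula α} (h : CKAxiom φ) : Slash Ax Γ φ := by
  induction h with
  | a1 φ ψ => exact ⟨ck (.a1 _ _), fun h => ⟨h.hilbert.const, fun _ => h⟩⟩
  | a2 φ ψ χ =>
    exact ⟨ck (.a2 _ _ _), fun h => ⟨ck_mp (.a2 _ _ _) h.1, fun h' =>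
      ⟨.mp h'.1 (ck_mp (.a2 _ _ _) h.1), fun hφ => (h.2 hφ).2 (h'.2 hφ)⟩⟩⟩
  | a3 φ ψ => exact ⟨ck (.a3 _ _), .inl⟩
  | a4 φ ψ => exact ⟨ck (.a4 _ _), .inr⟩
  | a5 φ ψ χ =>
    exact ⟨ck (.a5 _ _ _), fun h => ⟨ck_mp (.a5 _ _ _) h.1, fun h' =>
      ⟨.mp h'.1 (ck_mp (.a5 _ _ _) h.1), fun hor => hor.elim h.2 h'.2⟩⟩⟩
  | a6 φ ψ => exact ⟨ck (.a6 _ _), And.left⟩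
  | a7 φ ψ => exact ⟨ck (.a7 _ _), And.right⟩
  | a8 φ ψ χ =>
    exact ⟨ck (.a8 _ _ _), fun h => ⟨ck_mp (.a8 _ _ _) h.1, fun h' =>
      ⟨.mp h'.1 (ck_mp (.a8 _ _ _) h.1), fun hφ => ⟨h.2 hφ, h'.2 hφ⟩⟩⟩⟩
  | a9 φ => exact ⟨ck (.a9 _), False.elim⟩
  | kBox φ ψ =>
    exact ⟨ck (.kBox _ _), fun h => ⟨ck_mp (.kBox _ _) (Slash.hilbert h), fun hφ => .mp hφ h⟩⟩
  | kDia φ ψ =>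
    exact ⟨ck (.kDia _ _), fun h => ⟨ck_mp (.kDia _ _) (Slash.hilbert (φ := box _) h),
      fun ⟨γ, hγ, hφ⟩ => ⟨γ, hγ, .mp hφ (weaken h)⟩⟩⟩

end Slash

/-! ### Completeness -/

section Completeness

open Hilbert

variable {Ax : Formula α → Prop} [ContainsCK Ax]
  {P : Multiset (Formula α) → Formula α → Prop}

/-- If the formula `γ` of the antecedent is not slashed, then some left rule with principal
formula `γ` reduces the sequent to smaller derivable ones. -/
theorem G4Closed.of_not_slash (hP : G4Closed P) {Γ : Multiset (Formula α)} {γ δ : Formula α}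
    (ih : ∀ (Γ' : Multiset (Formula α)) (δ' : Formula α),
      totalSize Γ' + δ'.size < totalSize (γ ::ₘ Γ) + δ.size →
      Hilbert Ax {x | x ∈ Γ'} δ' → P Γ' δ')
    (h : Hilbert Ax {x | x ∈ γ ::ₘ Γ} δ) (hγ : ¬ Slash Ax (γ ::ₘ Γ) γ) : P (γ ::ₘ Γ) δ := by
  rw [setOf_mem_cons] at h
  have sub {φ ψ : Formula α} {S : Set (Formula α)} : S ⊆ insert φ (insert ψ S) :=
    (Set.subset_insert _ _).trans (Set.subset_insert _ _)
  have hδ := δ.size_pos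
  cases γ with
  | var p => exact absurd (Multiset.mem_cons_self _ _) hγ
  | bot => exact hP.botL _ _
  | and φ ψ =>
    refine hP.andL (ih _ _ ?_ ?_)
    · have := Formula.size_add_lt (φ := φ) (ψ := ψ) (χ := and φ ψ)
        (by simp only [Formula.weight]; omega) (by simp only [Formula.weight]; omega)
      simp only [totalSize_cons]; omega
    · simp only [setOf_mem_cons]
      exact h.replace (and_intro self_insert self_insert.weaken) sub
  | or φ ψ =>
    have := Formula.size_add_lt (φ := φ) (ψ := ψ) (χ := or φ ψ)
      (by simp only [Formula.weight]; omega) (by simp only [Formula.weight]; omega)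
    refine hP.orL (ih _ _ ?_ ?_) (ih _ _ ?_ ?_)
    · simp only [totalSize_cons]; omega
    · rw [setOf_mem_cons]
      exact h.replace self_insert.or_inl (Set.subset_insert _ _)
    · simp only [totalSize_cons]; omega
    · rw [setOf_mem_cons]
      exact h.replace self_insert.or_inr (Set.subset_insert _ _)
  -- Modal formulas of the antecedent are always slashed, so they are never the `γ` in question.
  | box φ => exact absurd (.el (mem_boxInv.2 (Multiset.mem_cons_self _ _))) hγ
  | dia φ => exact absurd ⟨φ, Multiset.mem_cons_self _ _, self_insert⟩ hγ
  | imp φ χ =>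
    -- An implication in the antecedent is derivable, so it fails to be slashed only if `φ` is
    -- slashed and `χ` is not. The slash of `φ` then provides what the left implication rule for the
    -- shape of `φ` requires.
    have hs : Slash Ax (imp φ χ ::ₘ Γ) φ := by
      by_contra hφ
      exact hγ ⟨.el (Multiset.mem_cons_self _ _), fun h => absurd h hφ⟩
    have hχ : Hilbert Ax {x | x ∈ χ ::ₘ Γ} δ := by
      rw [setOf_mem_cons]
      exact h.replace self_insert.const (Set.subset_insert _ _)
    have hχs : χ.size < (imp φ χ).size :=
      Formula.size_lt (by simp only [Formula.weight]; omega)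
    have hφs : φ.size < (imp φ χ).size :=
      Formula.size_lt (by simp only [Formula.weight]; omega)
    have ihχ : P (χ ::ₘ Γ) δ := ih _ _ (by simp only [totalSize_cons]; omega) hχ
    cases φ with
    | var p =>
      obtain ⟨Γ, rfl⟩ : ∃ Γ', Γ = var p ::ₘ Γ' :=
        Multiset.exists_cons_of_mem ((Multiset.mem_cons.1 hs).resolve_left nofun)
      rw [Multiset.cons_swap] at ihχ ⊢
      exact hP.varImpL ihχ
    -- `⊥ → χ` in the antecedent is always slashed, which is why no left rule for it is needed.
    | bot => exact hs.elim
    | and φ ψ =>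
      refine hP.andImpL (ih _ _ ?_ ?_)
      · have := Formula.size_lt (φ := imp φ (imp ψ χ)) (χ := imp (and φ ψ) χ)
          (by simp only [Formula.weight]; omega)
        simp only [totalSize_cons]; omega
      · rw [setOf_mem_cons]
        exact h.replace (deduct <| .mp self_insert.and_right <|
          .mp self_insert.and_left self_insert.weaken) (Set.subset_insert _ _)
    | or φ ψ =>
      refine hP.orImpL (ih _ _ ?_ ?_)
      · have := Formula.size_add_lt (φ := imp φ χ) (ψ := imp ψ χ) (χ := imp (or φ ψ) χ)
          (by simp only [Formula.weight]; omega) (by simp only [Formula.weight]; omega)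
        simp only [totalSize_cons]; omega
      · simp only [setOf_mem_cons]
        exact h.replace (deduct <| self_insert.or_elim
          (.mp self_insert self_insert.weaken.weaken)
          (.mp self_insert self_insert.weaken.weaken.weaken)) sub
    | imp φ ψ =>
      refine hP.impImpL (ih _ _ ?_ ?_) ihχ
      -- Both the new antecedent formula and the new succedent are paid for by the principal
      -- formula.
      · have := Formula.size_add_lt (φ := imp ψ χ) (ψ := imp φ ψ) (χ := imp (imp φ ψ) χ)
          (by simp only [Formula.weight]; omega) (by simp only [Formula.weight]; omega)
        simp only [totalSize_cons]; omega
      · have := hs.1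
        rw [setOf_mem_cons] at this ⊢
        exact imp_imp_iff.1 this
    | box φ =>
      have hs : Hilbert Ax {x | x ∈ boxInv (imp (box φ) χ ::ₘ Γ)} φ := hs
      rw [boxInv_cons rfl] at hs
      refine hP.boxImpL (ih _ _ ?_ hs) ihχ
      have := totalSize_boxInv_le Γ
      have : φ.size < (box φ).size := Formula.size_lt (by simp [Formula.weight])
      simp only [totalSize_cons]; omega
    | dia φ =>
      obtain ⟨γ, hγ, hs⟩ := hs
      obtain ⟨Γ, rfl⟩ : ∃ Γ', Γ = dia γ ::ₘ Γ' :=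
        Multiset.exists_cons_of_mem ((Multiset.mem_cons.1 hγ).resolve_left nofun)
      rw [boxInv_cons rfl, boxInv_cons rfl, ← setOf_mem_cons] at hs
      rw [Multiset.cons_swap] at ihχ ⊢
      refine hP.diaImpL (ih _ _ ?_ hs) ihχ
      have := totalSize_boxInv_le Γ
      have : φ.size < (dia φ).size := Formula.size_lt (by simp [Formula.weight])
      have : γ.size < (dia γ).size := Formula.size_lt (by simp [Formula.weight])
      simp only [totalSize_cons]; omega

/-- Completeness of any relation closed under the rules of `G4CK`, and under the additional
diamond rule of `G4WK` if `¬◇⊥` is an axiom. -/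
theorem G4Closed.complete (hP : G4Closed P)
    (hN : ∀ {Γ : Multiset (Formula α)} {φ δ : Formula α}, Ax (neg (dia bot)) →
      P (φ ::ₘ boxInv Γ) bot → P (dia φ ::ₘ Γ) δ)
    (hAx : ∀ φ, Ax φ → CKAxiom φ ∨ φ = neg (dia bot))
    {Γ : Multiset (Formula α)} {δ : Formula α} (h : Hilbert Ax {x | x ∈ Γ} δ) : P Γ δ := by
  induction hn : totalSize Γ + δ.size using Nat.strong_induction_on generalizing Γ δ with
  | _ n ih =>
  subst hn
  replace ih (Γ' : Multiset (Formula α)) (δ' : Formula α)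
      (hlt : totalSize Γ' + δ'.size < totalSize Γ + δ.size)
      (h : Hilbert Ax {x | x ∈ Γ'} δ') : P Γ' δ' := ih _ hlt h rfl
  by_cases hΓ : ∀ γ ∈ Γ, Slash Ax Γ γ
  swap
  · push Not at hΓ
    obtain ⟨γ, hγ, hs⟩ := hΓ
    obtain ⟨Γ, rfl⟩ := Multiset.exists_cons_of_mem hγ
    exact hP.of_not_slash ih h hs
  -- The only obstacle to slashing an axiom: `¬◇⊥` is an axiom while `◇⊥` is slashed.
  by_cases hb : Ax (neg (dia bot)) ∧ Slash Ax Γ (dia bot)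
  · obtain ⟨hn, γ, hγ, hb⟩ := hb
    obtain ⟨Γ, rfl⟩ := Multiset.exists_cons_of_mem hγ
    rw [boxInv_cons rfl, ← setOf_mem_cons] at hb
    refine hN hn (ih _ _ ?_ hb)
    have := totalSize_boxInv_le Γ
    have : γ.size + (bot : Formula α).size < (dia γ).size := Formula.size_add_lt
      (by simp [Formula.weight]) (by cases γ <;> simp [Formula.weight])
    simp only [totalSize_cons]; omega
  have hslash : Slash Ax Γ δ := by
    refine Hilbert.slash (fun φ hφ => ?_) hΓ h
    rcases hAx φ hφ with hφ | rfl
    · exact hφ.slash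
    · exact ⟨.ax hφ, fun hd => hb ⟨hφ, hd⟩⟩
  cases δ with
  | var p =>
    obtain ⟨Γ, rfl⟩ := Multiset.exists_cons_of_mem hslash
    exact hP.idP _ _
  | bot => exact hslash.elim
  | and φ ψ =>
    have := Formula.size_add_lt (φ := φ) (ψ := ψ) (χ := and φ ψ)
      (by simp only [Formula.weight]; omega) (by simp only [Formula.weight]; omega)
    exact hP.andR (ih _ _ (by omega) h.and_left) (ih _ _ (by omega) h.and_right)
  | or φ ψ =>
    have := Formula.size_add_lt (φ := φ) (ψ := ψ) (χ := or φ ψ)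
      (by simp only [Formula.weight]; omega) (by simp only [Formula.weight]; omega)
    -- The disjunction property: the slash decides which right rule applies.
    rcases hslash with hs | hs
    · exact hP.orR₁ (ih _ _ (by omega) hs.hilbert)
    · exact hP.orR₂ (ih _ _ (by omega) hs.hilbert)
  | imp φ ψ =>
    have := Formula.size_add_lt (φ := φ) (ψ := ψ) (χ := imp φ ψ)
      (by simp only [Formula.weight]; omega) (by simp only [Formula.weight]; omega)
    refine hP.impR (ih _ _ (by simp only [totalSize_cons]; omega) ?_)
    rw [setOf_mem_cons]
    exact h.undeduct
  | box φ =>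
    have := totalSize_boxInv_le Γ
    have : φ.size < (box φ).size := Formula.size_lt (by simp [Formula.weight])
    exact hP.boxR (ih _ _ (by omega) hslash)
  | dia φ =>
    obtain ⟨γ, hγ, hs⟩ := hslash
    obtain ⟨Γ, rfl⟩ := Multiset.exists_cons_of_mem hγ
    rw [boxInv_cons rfl, ← setOf_mem_cons] at hs
    refine hP.diaL (ih _ _ ?_ hs)
    have := totalSize_boxInv_le Γ
    have : φ.size < (dia φ).size := Formula.size_lt (by simp [Formula.weight])
    have : γ.size < (dia γ).size := Formula.size_lt (by simp [Formula.weight])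
    simp only [totalSize_cons]; omega

end Completeness

/-! ### The two equivalences -/

theorem WKAxiom.hilbert_diaL {Γ : Multiset (Formula α)} {φ δ : Formula α}
    (h : Hilbert WKAxiom {x | x ∈ φ ::ₘ boxInv Γ} bot) :
    Hilbert WKAxiom {x | x ∈ dia φ ::ₘ Γ} δ := by
  rw [setOf_mem_cons] at h ⊢
  exact .exfalso <| .mp (h.dia_mono (fun _ hτ => .inr (mem_boxInv.1 hτ)) .self_insert) (.ax .n)

theorem g4CK_iff {Γ : Multiset (Formula α)} {δ : Formula α} :
    G4CK Γ δ ↔ CKH {φ | φ ∈ Γ} δ :=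
  -- `nofun`: `¬◇⊥` is not an instance of any axiom of `CKH`.
  ⟨G4CK.sound g4Closed_hilbert, g4Closed_G4CK.complete nofun fun _ => .inl⟩

theorem g4WK_iff {Γ : Multiset (Formula α)} {Δ : Option (Formula α)} :
    G4WK Γ Δ ↔ WKH {φ | φ ∈ Γ} (succedentFormula Δ) := by
  refine ⟨G4WK.sound g4Closed_hilbert WKAxiom.hilbert_diaL, fun h => ?_⟩
  -- Completeness yields singleton succedents only; `G4WK.exfalso` then replaces `⊥` by the empty
  -- succedent.
  have h' : G4WK Γ (some (succedentFormula Δ)) := by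
    refine g4Closed_G4WK.complete (fun _ h => .diaL' (h.exfalso (.inr rfl) _)) ?_ h
    rintro _ (hφ | _)
    exacts [.inl hφ, .inr rfl]
  cases Δ with
  | none => exact h'.exfalso (.inr rfl) none
  | some δ => exact h'

end ConstructiveModal

theorem theorem2 {α : Type*} :
    (∀ (Γ : Multiset (ConstructiveModal.Formula α)) (δ : ConstructiveModal.Formula α),
      ConstructiveModal.G4CK Γ δ ↔ ConstructiveModal.CKH {φ | φ ∈ Γ} δ) ∧
    (∀ (Γ : Multiset (ConstructiveModal.Formula α)) (Δ : Option (ConstructiveModal.Formula α)),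
      ConstructiveModal.G4WK Γ Δ ↔
        ConstructiveModal.WKH {φ | φ ∈ Γ} (ConstructiveModal.succedentFormula Δ)) :=
  ⟨fun _ _ => ConstructiveModal.g4CK_iff, fun _ _ => ConstructiveModal.g4WK_iff⟩
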